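/- Let $\mathcal H$ be a complex Hilbert space with an orthonormal basis $(e_n)_{n\in\mathbb Z}$, and let $S$ be a bounded bilateral weighted shift on $\mathcal H$: $Se_n=\omega_n e_{n+1}$ for all $n\in\mathbb Z$, where $(\omega_n)_{n\in\mathbb Z}$ is a bounded sequence of positive numbers. Put $\beta_0=1$, $\beta_n=\omega_0\cdots\omega_{n-1}$ for $n>0$ and $\beta_n=\frac{1}{\omega_n\cdots\omega_{-1}}$ for $n<0$, and let $$r_2^-(S)=\liminf_{n\to+\infty}\Big[\frac1{\beta_{-n}}\Big]^{1/n},\qquad r_3^+(S)=\limsup_{n\to+\infty}[\beta_n]^{1/n},\qquad r_1(S)=\sup_{n\ge1}[m(S^n)]^{1/n},$$ where $m(T)=\inf\{\|Tx\|:\|x\|=1\}$; let $r(T)$ denote the spectral radius of $T$. For a bounded operator $T$ on $\mathcal H$ and $x\in\mathcal H$, let $\sigma_T(x)$ be the complement in $\mathbb C$ of the union of all open sets $U\subset\mathbb C$ for which there is an analytic function $f:U\to\mathcal H$ with $(T-\lambda)f(\lambda)=x$ for all $\lambda\in U$. The operator $T$ satisfies Dunford's condition (C) if $\{x\in\mathcal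 H:\sigma_T(x)\subset F\}$ is closed in $\mathcal H$ for every closed set $F\subset\mathbb C$. Assume that $S$ satisfies Dunford's condition (C). (a) If $S$ is not invertible, then $r_1(S)=r_2^-(S)=0\le r_3^+(S)=r(S)$. (b) If $S$ is invertible, then $r_1(S)=\dfrac{1}{r(S^{-1})}=r_2^-(S)\le r_3^+(S)=r(S)$. -/

import Mathlib

open scoped ENNReal

noncomputable section

variable {H : Type*} [NormedAddCommGroup H] [InnerProductSpace ℂ H]

/-- The local resolvent set of `T` at `x`: the union of all open `U ⊆ ℂ` on which there is an
analytic `H`-valued function `f` with `(T - μ) f(μ) = x` for all `μ ∈ U`. -/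
def localResolventSet (T : H →L[ℂ] H) (x : H) : Set ℂ :=
  ⋃₀ {U : Set ℂ | IsOpen U ∧ ∃ f : ℂ → H, AnalyticOnNhd ℂ f U ∧
    ∀ μ ∈ U, (T - μ • ContinuousLinearMap.id ℂ H) (f μ) = x}

/-- The local spectrum of `T` at `x`. -/
def localSpectrum (T : H →L[ℂ] H) (x : H) : Set ℂ :=
  (localResolventSet T x)ᶜ

/-- The analytic spectral subspace of `T` associated with `F`. -/
def analyticSpectralSubspace (T : H →L[ℂ] H) (F : Set ℂ) : Set H :=
  {x : H | localSpectrum T x ⊆ F}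

/-- Dunford's condition (C): all analytic spectral subspaces of closed sets are closed. -/
def DunfordConditionC (T : H →L[ℂ] H) : Prop :=
  ∀ F : Set ℂ, IsClosed F → IsClosed (analyticSpectralSubspace T F)

/-- The lower bound `m(T) = inf {‖T x‖ : ‖x‖ = 1}`. -/
def lowerBound (T : H →L[ℂ] H) : ℝ≥0∞ :=
  ⨅ (x : H) (_ : ‖x‖ = 1), ‖T x‖ₑ

/-- `r₁(T) = sup_{n ≥ 1} m(Tⁿ)^{1/n}`. -/
def rOne (T : H →L[ℂ] H) : ℝ≥0∞ :=
  ⨆ (n : ℕ) (_ : 1 ≤ n), lowerBound (T ^ n) ^ (1 / (n : ℝ))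

/-- `S` is the bilateral weighted shift with positive weights `ω` relative to the orthonormal
(Hilbert) basis `e`. The weights are automatically bounded, since `S` is. -/
structure IsBilateralWeightedShift (e : HilbertBasis ℤ ℂ H) (ω : ℤ → ℝ) (S : H →L[ℂ] H) :
    Prop where
  weight_pos : ∀ n, 0 < ω n
  apply_basis : ∀ n, S (e n) = (ω n : ℂ) • e (n + 1)

/-- `β n = ω 0 ⋯ ω (n-1)` for `n ≥ 0` and `β n = 1 / (ω n ⋯ ω (-1))` for `n < 0`. -/
def shiftBeta (ω : ℤ → ℝ) (n : ℤ) : ℝ :=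
  if 0 ≤ n then ∏ k ∈ Finset.Ico 0 n, ω k else 1 / ∏ k ∈ Finset.Ico n 0, ω k

/-- `r₂⁻ = liminf (1 / β (-n))^{1/n}`. -/
def rTwoMinus (ω : ℤ → ℝ) : ℝ≥0∞ :=
  Filter.liminf
    (fun n : ℕ => ENNReal.ofReal ((1 / shiftBeta ω (-(n : ℤ))) ^ (1 / (n : ℝ)))) Filter.atTop

/-- `r₃⁺ = limsup (β n)^{1/n}`. -/
def rThreePlus (ω : ℤ → ℝ) : ℝ≥0∞ :=
  Filter.limsup
    (fun n : ℕ => ENNReal.ofReal (shiftBeta ω (n : ℤ) ^ (1 / (n : ℝ)))) Filter.atTop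

end

open Filter Topology Metric Function
open scoped NNReal

/-!
A bilateral weighted shift moves the rescaled basis vectors `w n = β n • e n` one step forward, so
`r₃⁺` and `1 / r₂⁻` are the growth rates of the forward and backward orbits of `w 0`. Summing
geometric series along these orbits solves `(S - μ) f(μ) = w k` analytically for `‖μ‖ > r₃⁺` and for
`‖μ‖ < r₂⁻`. The vectors `w k` span a dense subspace, and condition (C) lets the solutions pass to
its closure: `S - μ` is onto for all such `μ`. Finally, a surjective operator which is a limit of
invertible ones is invertible, so that `T - μ` cannot be onto when `μ` is a spectral value of
maximal modulus. This yields `r(S) ≤ r₃⁺` and `r(S⁻¹) ≤ 1 / r₂⁻`, and the reverse inequalities hold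
because an orbit cannot grow faster than the powers of the operator.
-/

section LocalSpectralTheory

variable {H : Type*} [NormedAddCommGroup H] [InnerProductSpace ℂ H] {T : H →L[ℂ] H} {x : H}

theorem localResolventSet_inter_subset_add (T : H →L[ℂ] H) (x y : H) :
    localResolventSet T x ∩ localResolventSet T y ⊆ localResolventSet T (x + y) := by
  rintro μ ⟨⟨U, ⟨hU, f, hf, hfx⟩, hμU⟩, ⟨V, ⟨hV, g, hg, hgy⟩, hμV⟩⟩
  refine ⟨U ∩ V, ⟨hU.inter hV, f + g, fun z hz => (hf z hz.1).add (hg z hz.2), fun z hz => ?_⟩,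
    hμU, hμV⟩
  rw [Pi.add_apply, map_add, hfx z hz.1, hgy z hz.2]

theorem localResolventSet_subset_smul (T : H →L[ℂ] H) (c : ℂ) (x : H) :
    localResolventSet T x ⊆ localResolventSet T (c • x) := by
  rintro μ ⟨U, ⟨hU, f, hf, hfx⟩, hμU⟩
  refine ⟨U, ⟨hU, c • f, fun z hz => (hf z hz).const_smul, fun z hz => ?_⟩, hμU⟩
  rw [Pi.smul_apply, map_smul, hfx z hz]

theorem localResolventSet_zero (T : H →L[ℂ] H) : localResolventSet T 0 = Set.univ :=
  Set.eq_univ_of_forall fun _ =>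
    ⟨Set.univ, ⟨isOpen_univ, fun _ => 0, fun _ _ => analyticAt_const, by simp⟩, trivial⟩

theorem mem_analyticSpectralSubspace_iff {F : Set ℂ} :
    x ∈ analyticSpectralSubspace T F ↔ Fᶜ ⊆ localResolventSet T x :=
  Set.compl_subset_comm

/-- The analytic spectral subspace, bundled as a linear subspace of the Hilbert space. -/
def analyticSpectralSubmodule (T : H →L[ℂ] H) (F : Set ℂ) : Submodule ℂ H where
  carrier := analyticSpectralSubspace T F
  add_mem' {x y} hx hy := by
    rw [mem_analyticSpectralSubspace_iff] at hx hy ⊢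
    exact (Set.subset_inter hx hy).trans (localResolventSet_inter_subset_add T x y)
  zero_mem' := by
    rw [mem_analyticSpectralSubspace_iff, localResolventSet_zero]
    exact Set.subset_univ _
  smul_mem' c x hx := by
    rw [mem_analyticSpectralSubspace_iff] at hx ⊢
    exact hx.trans (localResolventSet_subset_smul T c x)

theorem exists_sub_smul_apply_eq_of_mem_localResolventSet {μ : ℂ}
    (h : μ ∈ localResolventSet T x) : ∃ y, (T - μ • ContinuousLinearMap.id ℂ H) y = x := by
  obtain ⟨U, ⟨-, f, -, hf⟩, hμ⟩ := h
  exact ⟨f μ, hf μ hμ⟩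

theorem DunfordConditionC.surjective_sub_smul (hT : DunfordConditionC T) {F : Set ℂ}
    (hF : IsClosed F) {s : Set H} (hs : Dense (Submodule.span ℂ s : Set H))
    (hsF : s ⊆ analyticSpectralSubspace T F) {μ : ℂ} (hμ : μ ∉ F) :
    Surjective (T - μ • ContinuousLinearMap.id ℂ H) := by
  have hspan : (Submodule.span ℂ s : Set H) ⊆ analyticSpectralSubspace T F :=
    Submodule.span_le (p := analyticSpectralSubmodule T F).2 hsF
  intro x
  have hx : x ∈ analyticSpectralSubspace T F := closure_minimal hspan (hT F hF) (hs x)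
  exact exists_sub_smul_apply_eq_of_mem_localResolventSet
    (mem_analyticSpectralSubspace_iff.1 hx hμ)

end LocalSpectralTheory

section PowerSeries

variable {E : Type*} [NormedAddCommGroup E] [NormedSpace ℂ E] {v : ℕ → E} {r : ℝ} {z : ℂ}

theorem norm_pow_smul_le_of_mem_ball (v : ℕ → E) (hz : z ∈ ball 0 r) (n : ℕ) :
    ‖z ^ n • v n‖ ≤ r ^ n * ‖v n‖ := by
  rw [norm_smul, norm_pow]
  gcongr
  exact (mem_ball_zero_iff.1 hz).le

variable [CompleteSpace E]

theorem summable_pow_smul_of_mem_ball (hs : Summable fun n => r ^ n * ‖v n‖) (hz : z ∈ ball 0 r) :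
    Summable fun n => z ^ n • v n :=
  .of_norm_bounded hs (norm_pow_smul_le_of_mem_ball v hz)

theorem analyticOnNhd_tsum_pow_smul (hs : Summable fun n => r ^ n * ‖v n‖) :
    AnalyticOnNhd ℂ (fun z : ℂ => ∑' n, z ^ n • v n) (ball 0 r) :=
  (Complex.differentiableOn_tsum_of_summable_norm hs (fun _ => by fun_prop) isOpen_ball
    fun n _ hz => norm_pow_smul_le_of_mem_ball v hz n).analyticOnNhd isOpen_ball

end PowerSeries

section Orbits

variable {H : Type*} [NormedAddCommGroup H] [InnerProductSpace ℂ H] [CompleteSpace H]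
  {T : H →L[ℂ] H} {v : ℕ → H} {r : ℝ}

theorem ball_subset_localResolventSet {x : H} (h0 : T (v 0) = x) (hv : ∀ n, T (v (n + 1)) = v n)
    (hs : Summable fun n => r ^ n * ‖v n‖) : ball 0 r ⊆ localResolventSet T x := by
  refine Set.subset_sUnion_of_mem ⟨isOpen_ball, _, analyticOnNhd_tsum_pow_smul hs, fun z hz => ?_⟩
  have hsum := summable_pow_smul_of_mem_ball hs hz
  have hT : T (∑' n, z ^ n • v n) = x + z • ∑' n, z ^ n • v n := by
    rw [T.map_tsum hsum, (hsum.mapL T).tsum_eq_zero_add, ← tsum_const_smul'']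
    simp [h0, hv, pow_succ', mul_smul]
  simp [hT]

theorem compl_closedBall_subset_localResolventSet (hr : 0 < r) (hv : ∀ n, T (v n) = v (n + 1))
    (hs : Summable fun n => r⁻¹ ^ n * ‖v n‖) :
    (closedBall 0 r)ᶜ ⊆ localResolventSet T (v 0) := by
  have hne : ∀ z ∈ (closedBall (0 : ℂ) r)ᶜ, z ≠ 0 := by
    rintro _ hz rfl
    exact hz (mem_closedBall_self hr.le)
  have hinv : Set.MapsTo Inv.inv (closedBall (0 : ℂ) r)ᶜ (ball 0 r⁻¹) := fun z hz => by
    rw [mem_ball_zero_iff, norm_inv]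
    exact inv_strictAnti₀ hr (by simpa using hz)
  have hinv_an : AnalyticOnNhd ℂ (Inv.inv : ℂ → ℂ) (closedBall 0 r)ᶜ := fun z hz =>
    analyticAt_inv (hne z hz)
  refine Set.subset_sUnion_of_mem ⟨isClosed_closedBall.isOpen_compl,
    fun z => -(z⁻¹ • ∑' n, z⁻¹ ^ n • v n),
    (hinv_an.smul ((analyticOnNhd_tsum_pow_smul hs).comp hinv_an hinv)).neg, fun z hz => ?_⟩
  have hz0 := hne z hz
  have hsum := summable_pow_smul_of_mem_ball hs (hinv hz)
  have hT : ∑' n, z⁻¹ ^ n • v n = v 0 + z⁻¹ • T (∑' n, z⁻¹ ^ n • v n) := by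
    rw [T.map_tsum hsum, ← tsum_const_smul'']
    conv_lhs => rw [hsum.tsum_eq_zero_add]
    simp [hv, pow_succ', mul_smul]
  have hTinv : z⁻¹ • T (∑' n, z⁻¹ ^ n • v n) = ∑' n, z⁻¹ ^ n • v n - v 0 :=
    eq_sub_of_add_eq' hT.symm
  simp [smul_smul, hz0, hTinv, -inv_pow]

end Orbits

section GrowthRate

variable {E : Type*} [NormedAddCommGroup E]

/-- The exponential growth rate `limsup ‖v n‖^{1/n}` of a sequence of vectors, that is, the inverse
of the radius of convergence of `∑ zⁿ v n`. Along the orbit of a vector under an operator it is the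
local spectral radius. -/
noncomputable def growthRate (v : ℕ → E) : ℝ≥0∞ :=
  limsup (fun n => ‖v n‖ₑ ^ (1 / (n : ℝ))) atTop

theorem summable_inv_pow_mul_norm_of_growthRate_lt {v : ℕ → E} {r : ℝ≥0} (h : growthRate v < r) :
    Summable fun n => (r⁻¹ : ℝ) ^ n * ‖v n‖ := by
  obtain ⟨q, hvq, hqr⟩ := ENNReal.lt_iff_exists_nnreal_btwn.1 h
  have hr : 0 < r := ENNReal.coe_pos.1 (bot_le.trans_lt h)
  refine Summable.of_norm_bounded_eventually_nat (g := fun n => (q / r : ℝ) ^ n)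
    (summable_geometric_of_lt_one (by positivity) ((div_lt_one (by positivity)).2 ?_)) ?_
  · exact_mod_cast hqr
  filter_upwards [eventually_lt_of_limsup_lt hvq, eventually_gt_atTop 0] with n hn hn0
  have hvn : ‖v n‖ ≤ q ^ n := by
    rw [one_div] at hn
    have := (ENNReal.rpow_inv_le_iff (Nat.cast_pos.2 hn0)).1 hn.le
    rw [ENNReal.rpow_natCast, enorm_eq_nnnorm] at this
    exact_mod_cast this
  rw [Real.norm_of_nonneg (by positivity), div_pow, inv_pow, div_eq_inv_mul]
  gcongr

theorem growthRate_pow_apply_le_spectralRadius [NormedSpace ℂ E] [CompleteSpace E]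
    (T : E →L[ℂ] E) (x : E) : growthRate (fun n => (T ^ n) x) ≤ spectralRadius ℂ T := by
  have hle : ∀ n : ℕ, ‖(T ^ n) x‖ₑ ^ (1 / (n : ℝ)) ≤
      ‖T ^ n‖ₑ ^ (1 / (n : ℝ)) * (‖x‖ₑ + 1) ^ (1 / (n : ℝ)) := fun n => by
    rw [← ENNReal.mul_rpow_of_nonneg _ _ (by positivity)]
    gcongr
    exact ((T ^ n).le_opENorm x).trans (by gcongr; exact le_self_add)
  have hone : Tendsto (fun n : ℕ => (‖x‖ₑ + 1) ^ (1 / (n : ℝ))) atTop (𝓝 1) := by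
    have hpos : 0 < ‖x‖ + 1 := by positivity
    have := ENNReal.tendsto_ofReal (((Real.continuous_const_rpow hpos.ne').tendsto 0).comp
      tendsto_one_div_atTop_nhds_zero_nat)
    simpa [← ENNReal.ofReal_rpow_of_pos hpos, ENNReal.ofReal_add, Function.comp_def] using this
  have hlim := ENNReal.Tendsto.mul (spectrum.pow_nnnorm_pow_one_div_tendsto_nhds_spectralRadius T)
    (.inr ENNReal.one_ne_top) hone (.inl one_ne_zero)
  rw [mul_one] at hlim
  exact (limsup_le_limsup (.of_forall hle)).trans_eq hlim.limsup_eq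

theorem summable_pow_mul_natCast_add {a : ℤ → ℝ} {r : ℝ} (hr : r ≠ 0)
    (h : Summable fun n : ℕ => r ^ n * a n) (k : ℤ) :
    Summable fun n : ℕ => r ^ n * a (n + k) := by
  obtain ⟨m, rfl | rfl⟩ := k.eq_nat_or_neg
  · refine (((summable_nat_add_iff m).2 h).mul_left (r ^ m)⁻¹).congr fun n => ?_
    rw [pow_add]
    field_simp
    push_cast
    rfl
  · rw [← summable_nat_add_iff m]
    refine (h.mul_left (r ^ m)).congr fun n => ?_
    rw [pow_add, Nat.cast_add, add_neg_cancel_right]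
    ring

end GrowthRate

section SpectralRadius

theorem isUnit_of_mul_eq_one_of_mem_closure_isUnit {A : Type*} [NormedRing A]
    [HasSummableGeomSeries A] {a b : A} (hab : a * b = 1) (ha : a ∈ closure {u : A | IsUnit u}) :
    IsUnit a := by
  have hopen : IsOpen {x : A | IsUnit (x * b)} := Units.isOpen.preimage (continuous_mul_const b)
  obtain ⟨u, hub, hu⟩ := mem_closure_iff.1 ha _ hopen (by simp [hab])
  have hb : IsUnit b := hu.mul_left_iff.1 hub
  exact hb.mul_right_iff.1 (by simp [hab])

theorem algebraMap_sub_mem_closure_isUnit {A : Type*} [NormedRing A] [NormedAlgebra ℂ A]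
    {a : A} {μ : ℂ} (hμ : spectralRadius ℂ a ≤ ‖μ‖ₑ) :
    algebraMap ℂ A μ - a ∈ closure {u : A | IsUnit u} := by
  have hclosure : μ ∈ closure (closedBall (0 : ℂ) ‖μ‖)ᶜ := by
    rw [closure_compl, interior_closedBall']
    simp
  refine map_mem_closure (f := fun z => algebraMap ℂ A z - a) (by fun_prop) hclosure fun z hz => ?_
  refine spectrum.mem_resolventSet_of_spectralRadius_lt (hμ.trans_lt ?_)
  rw [enorm_eq_nnnorm, ENNReal.coe_lt_coe, ← NNReal.coe_lt_coe]
  simpa using hz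

theorem hasRightInverse_of_surjective {𝕜 E F : Type*} [RCLike 𝕜] [NormedAddCommGroup E]
    [InnerProductSpace 𝕜 E] [CompleteSpace E] [NormedAddCommGroup F] [NormedSpace 𝕜 F]
    [CompleteSpace F] {T : E →L[𝕜] F} (hT : Surjective T) : T.HasRightInverse := by
  have : CompleteSpace T.ker := T.isClosed_ker.completeSpace_coe
  let R : T.kerᗮ →L[𝕜] F := T ∘L T.kerᗮ.subtypeL
  have hinj : R.ker = ⊥ := by
    refine LinearMap.ker_eq_bot'.2 fun x hx => Subtype.ext ?_
    exact (Submodule.mem_bot 𝕜).1 (T.ker.inf_orthogonal_eq_bot ▸ ⟨hx, x.2⟩)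
  have hsurj : R.range = ⊤ := by
    refine LinearMap.range_eq_top.2 fun y => ?_
    obtain ⟨x, rfl⟩ := hT y
    have hproj : T (T.ker.starProjection x) = 0 := T.ker.starProjection_apply_mem x
    exact ⟨⟨_, T.ker.sub_starProjection_mem_orthogonal x⟩, by simp [R, hproj]⟩
  let L := ContinuousLinearEquiv.ofBijective R hinj hsurj
  exact ⟨T.kerᗮ.subtypeL ∘L (L.symm : F →L[𝕜] T.kerᗮ), L.apply_symm_apply⟩

theorem unit_inv_apply_apply {𝕜 E : Type*} [NormedField 𝕜] [NormedAddCommGroup E]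
    [NormedSpace 𝕜 E] (u : (E →L[𝕜] E)ˣ) (x : E) :
    (↑u⁻¹ : E →L[𝕜] E) ((u : E →L[𝕜] E) x) = x := by
  rw [← mul_apply_eq_comp, Units.inv_mul, one_apply_eq_self]

theorem surjective_inv_sub_smul {𝕜 E : Type*} [NormedField 𝕜] [NormedAddCommGroup E]
    [NormedSpace 𝕜 E] {u : (E →L[𝕜] E)ˣ} {μ : 𝕜} (hμ : μ ≠ 0)
    (h : Surjective ((u : E →L[𝕜] E) - μ⁻¹ • ContinuousLinearMap.id 𝕜 E)) :
    Surjective ((↑u⁻¹ : E →L[𝕜] E) - μ • ContinuousLinearMap.id 𝕜 E) := by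
  intro y
  obtain ⟨x, hx⟩ := h (-μ⁻¹ • (u : E →L[𝕜] E) y)
  refine ⟨x, ?_⟩
  have hfactor : (↑u⁻¹ : E →L[𝕜] E) x - μ • x =
      -μ • (↑u⁻¹ : E →L[𝕜] E) (((u : E →L[𝕜] E) - μ⁻¹ • ContinuousLinearMap.id 𝕜 E) x) := by
    simp [unit_inv_apply_apply, smul_sub, hμ, neg_add_eq_sub]
  rw [hx] at hfactor
  simpa [unit_inv_apply_apply, hμ] using hfactor

theorem spectralRadius_le_of_surjective_sub_smul {H : Type*} [NormedAddCommGroup H]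
    [InnerProductSpace ℂ H] [CompleteSpace H] {T : H →L[ℂ] H} {c : ℝ≥0∞}
    (h : ∀ μ : ℂ, c < ‖μ‖ₑ → Surjective (T - μ • ContinuousLinearMap.id ℂ H)) :
    spectralRadius ℂ T ≤ c := by
  cases subsingleton_or_nontrivial H
  · simp [spectrum.SpectralRadius.of_subsingleton]
  obtain ⟨μ, hμ, hr⟩ := spectrum.exists_nnnorm_eq_spectralRadius T
  by_contra! hc
  obtain ⟨B, hB⟩ := hasRightInverse_of_surjective (h μ (hc.trans_eq hr.symm))
  refine hμ (isUnit_of_mul_eq_one_of_mem_closure_isUnit (b := -B) ?_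
    (algebraMap_sub_mem_closure_isUnit hr.ge))
  ext y
  simpa [Algebra.algebraMap_eq_smul_one, neg_add_eq_sub] using hB y

theorem inv_spectralRadius_inv_le_spectralRadius {A : Type*} [NormedRing A] [NormedAlgebra ℂ A]
    [CompleteSpace A] [Nontrivial A] (u : Aˣ) :
    (spectralRadius ℂ (↑u⁻¹ : A))⁻¹ ≤ spectralRadius ℂ (u : A) := by
  obtain ⟨μ, hμ⟩ := spectrum.nonempty (u : A)
  have hμ0 : μ ≠ 0 := spectrum.ne_zero_of_mem_of_unit hμ
  have hμ_inv : μ⁻¹ ∈ spectrum ℂ (↑u⁻¹ : A) := by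
    simpa using (spectrum.inv_mem_iff (r := Units.mk0 μ hμ0) (a := u)).1 hμ
  calc (spectralRadius ℂ (↑u⁻¹ : A))⁻¹ ≤ (‖μ⁻¹‖ₑ)⁻¹ :=
        ENNReal.inv_le_inv.2 (le_iSup₂ (α := ℝ≥0∞) μ⁻¹ hμ_inv)
    _ = ‖μ‖ₑ := by rw [enorm_inv hμ0, inv_inv]
    _ ≤ spectralRadius ℂ (u : A) := le_iSup₂ (α := ℝ≥0∞) μ hμ

end SpectralRadius

section LowerBound

variable {H : Type*} [NormedAddCommGroup H] [InnerProductSpace ℂ H] {T : H →L[ℂ] H}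

theorem le_lowerBound_iff {c : ℝ≥0∞} : c ≤ lowerBound T ↔ ∀ x, c * ‖x‖ₑ ≤ ‖T x‖ₑ := by
  refine ⟨fun h x => ?_, fun h => le_iInf₂ fun x hx => ?_⟩
  · rcases eq_or_ne x 0 with rfl | hx
    · simp
    have hunit : ‖(‖x‖⁻¹ : ℂ) • x‖ = 1 := norm_smul_inv_norm hx
    have hle : c ≤ ‖T ((‖x‖⁻¹ : ℂ) • x)‖ₑ := 
      h.trans (iInf₂_le (f := fun (y : H) (_ : ‖y‖ = 1) => ‖T y‖ₑ) _ hunit)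
    rw [map_smul, enorm_smul, enorm_inv (by simpa using hx), ← ofReal_norm (‖x‖ : ℂ),
      Complex.norm_real, norm_norm, ofReal_norm, mul_comm, ← div_eq_mul_inv] at hle
    exact (ENNReal.le_div_iff_mul_le (.inl (by simpa using hx)) (.inl enorm_ne_top)).1 hle
  · simpa [← ofReal_norm, hx] using h x

theorem lowerBound_unit (u : (H →L[ℂ] H)ˣ) :
    lowerBound (u : H →L[ℂ] H) = ‖(↑u⁻¹ : H →L[ℂ] H)‖ₑ⁻¹ := by
  have hinj : Injective (u : H →L[ℂ] H) := LeftInverse.injective (unit_inv_apply_apply u)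
  have hsurj : Surjective (u : H →L[ℂ] H) :=
    LeftInverse.surjective (g := (↑u⁻¹ : H →L[ℂ] H)) (unit_inv_apply_apply u⁻¹)
  refine eq_of_forall_le_iff fun c => ?_
  rw [ENNReal.le_inv_iff_le_inv, ContinuousLinearMap.opENorm_le_iff, le_lowerBound_iff,
    hsurj.forall (p := fun y => ‖(↑u⁻¹ : H →L[ℂ] H) y‖ₑ ≤ c⁻¹ * ‖y‖ₑ)]
  refine forall_congr' fun x => ?_
  rcases eq_or_ne x 0 with rfl | hx
  · simp
  have hux : ‖(u : H →L[ℂ] H) x‖ₑ ≠ 0 := by simpa using (map_ne_zero_iff _ hinj).2 hx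
  rw [unit_inv_apply_apply, mul_comm c, mul_comm c⁻¹, ← div_eq_mul_inv,
    ENNReal.le_div_iff_mul_le (.inr hux) (.inr enorm_ne_top)]

theorem denseRange_pow {R M : Type*} [Semiring R] [TopologicalSpace M] [AddCommMonoid M]
    [Module R M] {T : M →L[R] M} (hT : DenseRange T) (n : ℕ) :
    DenseRange (T ^ n) := by
  induction n with
  | zero => exact denseRange_id
  | succ n ih => exact ih.comp hT (T ^ n).continuous

theorem isUnit_of_denseRange_of_lowerBound_ne_zero [CompleteSpace H] (hT : DenseRange T)
    (h : lowerBound T ≠ 0) : IsUnit T := by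
  obtain ⟨c, hc0, hc⟩ := ENNReal.lt_iff_exists_nnreal_btwn.1 (pos_iff_ne_zero.2 h)
  rw [ContinuousLinearMap.isUnit_iff_bijective,
    ContinuousLinearMap.bijective_iff_dense_range_and_antilipschitz]
  refine ⟨Submodule.dense_iff_topologicalClosure_eq_top.1 hT, c⁻¹, T.antilipschitz_of_bound ?_⟩
  intro x
  have hx := le_lowerBound_iff.1 hc.le x
  simp only [enorm_eq_nnnorm, ← ENNReal.coe_mul, ENNReal.coe_le_coe] at hx
  exact_mod_cast (le_inv_mul_iff₀ (ENNReal.coe_pos.1 hc0)).2 hx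

theorem rOne_eq_zero [CompleteSpace H] (hT : DenseRange T) (hu : ¬ IsUnit T) : rOne T = 0 := by
  refine le_bot_iff.1 (iSup₂_le fun n hn => ?_)
  have hn0 : n ≠ 0 := Nat.one_le_iff_ne_zero.1 hn
  have hbound : lowerBound (T ^ n) = 0 := by
    contrapose! hu
    exact (isUnit_pow_iff hn0).1
      (isUnit_of_denseRange_of_lowerBound_ne_zero (denseRange_pow hT n) hu)
  rw [hbound, ENNReal.zero_rpow_of_pos (by positivity), bot_eq_zero]

theorem rOne_unit [CompleteSpace H] (u : (H →L[ℂ] H)ˣ) :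
    rOne (u : H →L[ℂ] H) = (spectralRadius ℂ (↑u⁻¹ : H →L[ℂ] H))⁻¹ := by
  have hterm : ∀ n : ℕ, lowerBound ((u : H →L[ℂ] H) ^ n) ^ (1 / (n : ℝ)) =
      (‖(↑u⁻¹ : H →L[ℂ] H) ^ n‖ₑ ^ (1 / (n : ℝ)))⁻¹ := fun n => by
    rw [← Units.val_pow_eq_pow_val, lowerBound_unit, ENNReal.inv_rpow, ← inv_pow,
      Units.val_pow_eq_pow_val]
  simp only [rOne, hterm]
  refine le_antisymm (iSup₂_le fun n hn => ENNReal.inv_le_inv.2 ?_) ?_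
  · have hone : ‖(1 : H →L[ℂ] H)‖₊ ≤ 1 := ContinuousLinearMap.norm_id_le
    obtain ⟨m, rfl⟩ := Nat.exists_eq_add_of_le' hn
    refine (spectrum.spectralRadius_le_pow_nnnorm_pow_one_div ℂ _ m).trans ?_
    rw [enorm_eq_nnnorm, Nat.cast_succ]
    exact mul_le_of_le_one_right' (ENNReal.rpow_le_one (by exact_mod_cast hone) (by positivity))
  · refine le_of_tendsto
      (spectrum.pow_nnnorm_pow_one_div_tendsto_nhds_spectralRadius (↑u⁻¹ : H →L[ℂ] H)).inv ?_
    filter_upwards [eventually_ge_atTop 1] with n hn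
    exact le_iSup₂ (α := ℝ≥0∞) n hn

end LowerBound

section ShiftBeta

variable {ω : ℤ → ℝ}

theorem shiftBeta_pos (hω : ∀ n, 0 < ω n) (n : ℤ) : 0 < shiftBeta ω n := by
  unfold shiftBeta
  split_ifs
  · exact Finset.prod_pos fun k _ => hω k
  · exact one_div_pos.2 (Finset.prod_pos fun k _ => hω k)

theorem shiftBeta_of_nonpos {n : ℤ} (hn : n ≤ 0) :
    shiftBeta ω n = (∏ k ∈ Finset.Ico n 0, ω k)⁻¹ := by
  rcases hn.eq_or_lt with rfl | hn
  · simp [shiftBeta]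
  · rw [shiftBeta, if_neg hn.not_ge, one_div]

theorem shiftBeta_add_one (hω : ∀ n, ω n ≠ 0) (n : ℤ) :
    shiftBeta ω (n + 1) = ω n * shiftBeta ω n := by
  rcases le_or_gt 0 n with hn | hn
  · rw [shiftBeta, shiftBeta, if_pos hn, if_pos (by lia),
      ← Finset.insert_Ico_right_eq_Ico_add_one hn, Finset.prod_insert (by simp)]
  · rw [shiftBeta_of_nonpos hn.le, shiftBeta_of_nonpos hn,
      ← Finset.insert_Ico_add_one_left_eq_Ico hn, Finset.prod_insert (by simp), mul_inv,
      mul_inv_cancel_left₀ (hω n)]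

end ShiftBeta

section WeightedShift

variable {H : Type*} [NormedAddCommGroup H] [InnerProductSpace ℂ H]
  {e : HilbertBasis ℤ ℂ H} {ω : ℤ → ℝ} {S : H →L[ℂ] H}

/-- The rescaled basis `β n • e n`, on which the weighted shift acts as the plain shift. -/
noncomputable def rescaledBasis (e : HilbertBasis ℤ ℂ H) (ω : ℤ → ℝ) (n : ℤ) : H :=
  (shiftBeta ω n : ℂ) • e n

theorem enorm_rescaledBasis (e : HilbertBasis ℤ ℂ H) (hω : ∀ n, 0 < ω n) (n : ℤ) :
    ‖rescaledBasis e ω n‖ₑ = ENNReal.ofReal (shiftBeta ω n) := by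
  rw [← ofReal_norm, rescaledBasis, norm_smul, e.orthonormal.1 n, mul_one, Complex.norm_real,
    Real.norm_of_nonneg (shiftBeta_pos hω n).le]

theorem dense_span_rescaledBasis (e : HilbertBasis ℤ ℂ H) (hω : ∀ n, 0 < ω n) :
    Dense (Submodule.span ℂ (Set.range (rescaledBasis e ω)) : Set H) := by
  refine (Submodule.dense_iff_topologicalClosure_eq_top.2 e.dense_span).mono
    (Submodule.span_le.2 ?_)
  rintro _ ⟨n, rfl⟩
  have hβ : (shiftBeta ω n : ℂ) ≠ 0 := Complex.ofReal_ne_zero.2 (shiftBeta_pos hω n).ne'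
  rw [← inv_smul_smul₀ hβ (e n)]
  exact Submodule.smul_mem _ _ (Submodule.subset_span ⟨n, rfl⟩)

theorem growthRate_rescaledBasis (e : HilbertBasis ℤ ℂ H) (hω : ∀ n, 0 < ω n) :
    growthRate (fun n : ℕ => rescaledBasis e ω n) = rThreePlus ω := by
  simp only [growthRate, rThreePlus, enorm_rescaledBasis e hω,
    ENNReal.ofReal_rpow_of_pos (shiftBeta_pos hω _)]

theorem inv_growthRate_rescaledBasis_neg (e : HilbertBasis ℤ ℂ H) (hω : ∀ n, 0 < ω n) :
    (growthRate fun n : ℕ => rescaledBasis e ω (-n))⁻¹ = rTwoMinus ω := by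
  rw [growthRate, ENNReal.inv_limsup, rTwoMinus]
  refine congrArg (liminf · atTop) (funext fun n => ?_)
  have hβ := shiftBeta_pos hω (-n)
  rw [enorm_rescaledBasis e hω, ← ENNReal.inv_rpow, ← ENNReal.ofReal_inv_of_pos hβ,
    ENNReal.ofReal_rpow_of_pos (inv_pos.2 hβ), one_div (shiftBeta ω _)]

namespace IsBilateralWeightedShift

theorem apply_rescaledBasis (hS : IsBilateralWeightedShift e ω S) (n : ℤ) :
    S (rescaledBasis e ω n) = rescaledBasis e ω (n + 1) := by
  rw [rescaledBasis, rescaledBasis, map_smul, hS.apply_basis,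
    shiftBeta_add_one fun n => (hS.weight_pos n).ne', smul_smul, Complex.ofReal_mul, mul_comm]

theorem pow_apply_rescaledBasis (hS : IsBilateralWeightedShift e ω S) (n : ℕ) (k : ℤ) :
    (S ^ n) (rescaledBasis e ω k) = rescaledBasis e ω (k + n) := by
  induction n with
  | zero => simp
  | succ n ih =>
    rw [pow_succ', mul_apply_eq_comp, ih, hS.apply_rescaledBasis, Nat.cast_succ,
      add_assoc]

theorem inv_pow_apply_rescaledBasis {u : (H →L[ℂ] H)ˣ}
    (hS : IsBilateralWeightedShift e ω (u : H →L[ℂ] H)) (n : ℕ) (k : ℤ) :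
    ((↑u⁻¹ : H →L[ℂ] H) ^ n) (rescaledBasis e ω k) = rescaledBasis e ω (k - n) := by
  have h := hS.pow_apply_rescaledBasis n (k - n)
  rw [sub_add_cancel] at h
  rw [← h, ← Units.val_pow_eq_pow_val, ← Units.val_pow_eq_pow_val, ← mul_apply_eq_comp,
    ← Units.val_mul, inv_pow, inv_mul_cancel, Units.val_one, one_apply_eq_self]

theorem denseRange (hS : IsBilateralWeightedShift e ω S) : DenseRange S := by
  refine (dense_span_rescaledBasis e hS.weight_pos).mono
    (Submodule.span_le (p := S.range).2 ?_)
  rintro _ ⟨n, rfl⟩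
  exact ⟨rescaledBasis e ω (n - 1), (hS.apply_rescaledBasis _).trans (by rw [sub_add_cancel])⟩

theorem inner_basis_add_one_apply (hS : IsBilateralWeightedShift e ω S) (n : ℤ) (x : H) :
    inner ℂ (e (n + 1)) (S x) = ω n * inner ℂ (e n) x := by
  have heq : (innerSL ℂ (e (n + 1))) ∘L S = (ω n : ℂ) • innerSL ℂ (e n) := by
    refine ContinuousLinearMap.ext_on
      (Submodule.dense_iff_topologicalClosure_eq_top.2 e.dense_span) ?_
    rintro _ ⟨k, rfl⟩
    rcases eq_or_ne n k with rfl | hk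
    · simp [hS.apply_basis, e.orthonormal.1]
    · simp [hS.apply_basis, orthonormal_iff_ite.1 e.orthonormal, hk]
  exact congr($heq x)

theorem injective (hS : IsBilateralWeightedShift e ω S) : Injective S := by
  refine (injective_iff_map_eq_zero S).2 fun x hx => e.repr.map_eq_zero_iff.1 ?_
  ext n
  have hn := hS.inner_basis_add_one_apply n x
  rw [hx, inner_zero_right, zero_eq_mul] at hn
  simpa [e.repr_apply_apply] using hn.resolve_left (by exact_mod_cast (hS.weight_pos n).ne')

variable [CompleteSpace H]

theorem surjective_sub_smul_of_rThreePlus_lt (hS : IsBilateralWeightedShift e ω S)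
    (hC : DunfordConditionC S) {μ : ℂ} (hμ : rThreePlus ω < ‖μ‖ₑ) :
    Surjective (S - μ • ContinuousLinearMap.id ℂ H) := by
  obtain ⟨r, hωr, hrμ⟩ := ENNReal.lt_iff_exists_nnreal_btwn.1 hμ
  have hr : 0 < r := ENNReal.coe_pos.1 (bot_le.trans_lt hωr)
  rw [← growthRate_rescaledBasis e hS.weight_pos] at hωr
  have hμr : μ ∉ closedBall 0 (r : ℝ) := by
    rw [mem_closedBall_zero_iff, not_le]
    exact_mod_cast hrμ
  refine hC.surjective_sub_smul isClosed_closedBall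
    (dense_span_rescaledBasis e hS.weight_pos) ?_ hμr
  rintro _ ⟨k, rfl⟩
  have hsum := summable_pow_mul_natCast_add (a := fun n => ‖rescaledBasis e ω n‖) (by positivity)
    (summable_inv_pow_mul_norm_of_growthRate_lt hωr) k
  have horbit : ∀ n : ℕ, S (rescaledBasis e ω (n + k)) = rescaledBasis e ω ((n + 1 : ℕ) + k) :=
    fun n => by rw [hS.apply_rescaledBasis, Nat.cast_succ, add_right_comm]
  simpa [mem_analyticSpectralSubspace_iff] using
    compl_closedBall_subset_localResolventSet (by positivity) horbit hsum

theorem surjective_sub_smul_of_lt_rTwoMinus (hS : IsBilateralWeightedShift e ω S)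
    (hC : DunfordConditionC S) {μ : ℂ} (hμ : ‖μ‖ₑ < rTwoMinus ω) :
    Surjective (S - μ • ContinuousLinearMap.id ℂ H) := by
  obtain ⟨r, hμr, hrω⟩ := ENNReal.lt_iff_exists_nnreal_btwn.1 hμ
  have hr : r ≠ 0 := (ENNReal.coe_pos.1 (bot_le.trans_lt hμr)).ne'
  rw [← inv_growthRate_rescaledBasis_neg e hS.weight_pos, ENNReal.lt_inv_iff_lt_inv,
    ← ENNReal.coe_inv hr] at hrω
  have hμF : μ ∉ (ball 0 (r : ℝ))ᶜ := by
    rw [Set.notMem_compl_iff, mem_ball_zero_iff]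
    exact_mod_cast hμr
  refine hC.surjective_sub_smul isOpen_ball.isClosed_compl
    (dense_span_rescaledBasis e hS.weight_pos) ?_ hμF
  rintro _ ⟨k, rfl⟩
  have hsum := summable_pow_mul_natCast_add (a := fun n => ‖rescaledBasis e ω (-n)‖)
    (by simpa using hr) (summable_inv_pow_mul_norm_of_growthRate_lt hrω) (1 - k)
  rw [mem_analyticSpectralSubspace_iff, compl_compl]
  refine ball_subset_localResolventSet (v := fun n : ℕ => rescaledBasis e ω (-(n + (1 - k))))
    ?_ (fun n => ?_) (by simpa using hsum)
  · rw [hS.apply_rescaledBasis]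
    congr 1
    push_cast
    ring
  · rw [hS.apply_rescaledBasis]
    congr 1
    push_cast
    ring

theorem rThreePlus_eq_spectralRadius (hS : IsBilateralWeightedShift e ω S)
    (hC : DunfordConditionC S) : rThreePlus ω = spectralRadius ℂ S := by
  refine le_antisymm ?_ (spectralRadius_le_of_surjective_sub_smul fun μ =>
    hS.surjective_sub_smul_of_rThreePlus_lt hC)
  simpa [hS.pow_apply_rescaledBasis, growthRate_rescaledBasis e hS.weight_pos] using
    growthRate_pow_apply_le_spectralRadius S (rescaledBasis e ω 0)

theorem rTwoMinus_eq_zero (hS : IsBilateralWeightedShift e ω S) (hC : DunfordConditionC S)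
    (hu : ¬ IsUnit S) : rTwoMinus ω = 0 := by
  contrapose! hu
  have hsurj := hS.surjective_sub_smul_of_lt_rTwoMinus hC (μ := 0) (by simpa [pos_iff_ne_zero])
  rw [zero_smul, sub_zero] at hsurj
  exact ContinuousLinearMap.isUnit_iff_bijective.2 ⟨hS.injective, hsurj⟩

theorem rTwoMinus_eq_inv_spectralRadius_inv {u : (H →L[ℂ] H)ˣ}
    (hS : IsBilateralWeightedShift e ω (u : H →L[ℂ] H)) (hC : DunfordConditionC (u : H →L[ℂ] H)) :
    rTwoMinus ω = (spectralRadius ℂ (↑u⁻¹ : H →L[ℂ] H))⁻¹ := by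
  refine le_antisymm ?_ ?_
  · rw [ENNReal.le_inv_iff_le_inv]
    refine spectralRadius_le_of_surjective_sub_smul fun μ hμ => ?_
    have hμ0 : μ ≠ 0 := enorm_pos.1 (bot_le.trans_lt hμ)
    refine surjective_inv_sub_smul hμ0 (hS.surjective_sub_smul_of_lt_rTwoMinus hC ?_)
    rwa [enorm_inv hμ0, ENNReal.inv_lt_iff_inv_lt]
  · rw [← inv_growthRate_rescaledBasis_neg e hS.weight_pos, ENNReal.inv_le_inv]
    simpa [hS.inv_pow_apply_rescaledBasis] using
      growthRate_pow_apply_le_spectralRadius (↑u⁻¹ : H →L[ℂ] H) (rescaledBasis e ω 0)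

end IsBilateralWeightedShift

end WeightedShift

theorem theorem4 {H : Type*} [NormedAddCommGroup H] [InnerProductSpace ℂ H] [CompleteSpace H]
    (e : HilbertBasis ℤ ℂ H) (ω : ℤ → ℝ) (S : H →L[ℂ] H)
    (hS : IsBilateralWeightedShift e ω S) (hC : DunfordConditionC S) :
    (¬ IsUnit S →
      rOne S = rTwoMinus ω ∧ rTwoMinus ω = 0 ∧ 0 ≤ rThreePlus ω ∧
        rThreePlus ω = spectralRadius ℂ S) ∧
    (∀ hu : IsUnit S,
      rOne S = 1 / spectralRadius ℂ (↑hu.unit⁻¹ : H →L[ℂ] H) ∧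
        1 / spectralRadius ℂ (↑hu.unit⁻¹ : H →L[ℂ] H) = rTwoMinus ω ∧
        rTwoMinus ω ≤ rThreePlus ω ∧ rThreePlus ω = spectralRadius ℂ S) := by
  have : Nontrivial H := ⟨e 0, 0, e.orthonormal.ne_zero 0⟩
  have h3 := hS.rThreePlus_eq_spectralRadius hC
  refine ⟨fun hu => ?_, fun hu => ?_⟩
  · have h1 := rOne_eq_zero hS.denseRange hu
    have h2 := hS.rTwoMinus_eq_zero hC hu
    exact ⟨h1.trans h2.symm, h2, zero_le, h3⟩
  · obtain ⟨u, rfl⟩ := hu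
    have h2 := hS.rTwoMinus_eq_inv_spectralRadius_inv hC
    have hunit : (Units.isUnit u).unit = u := Units.ext rfl
    rw [hunit, one_div]
    refine ⟨rOne_unit u, h2.symm, ?_, h3⟩
    rw [h2, h3]
    exact inv_spectralRadius_inv_le_spectralRadius u
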